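/- Let $r,c\ge 1$ be integers and $n=r+c$. For a permutation $\varphi$ of $\{0,1\}^n$ let $\mathsf{Sp}^{\varphi}:(\{0,1\}^r)^*\to\{0,1\}^r$ be the sponge function with one round of squeezing: start from the state $0^r\|0^c$; for each $r$-bit block of the message in turn, XOR the block into the first $r$ bits of the state and apply $\varphi$ to the whole state; finally output the first $r$ bits of the state. Let $\varphi$ be a uniformly random permutation of $\{0,1\}^n$. A $q$-query adversary is a classical (randomized, adaptive, computationally unbounded) algorithm that makes in total at most $q$ queries to oracles for $\varphi$ and $\varphi^{-1}$. (1) Collision resistance. There is an absolute constant $C>0$ such that for all $r,c\ge 1$, all $l\le q$ and every $q$-query adversary $\mathcal A$, the probability (over $\varphi$ and the randomness of $\mathcal A$) that $\mathcal A^{\varphi,\varphi^{-1}}$ outputs messages $m\ne m'$ of at most $l$ blocks each with $\mathsf{Sp}^{\varphi}(m)=\mathsf{Sp}^{\varphi}(m')$ is at most $C\,q^4\,n\,2^{-\min(r,c)}$. Consequently, for every constant $p>0$ there is $\kappa>0$, depending only on $p$, such that every adversary with success probability at least $p$ (for some $l\le q$) has $q\ge\kappa\,(2^{\min(r,c)}/n)^{1/4}$.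 (2) Preimage resistance. There is an absolute constant $C>0$ such that for all $r,c\ge 1$, all $q\ge 1$ and $l\le q$, and every $q$-query adversary $\mathcal A$ that is given a uniformly random $y\in\{0,1\}^r$ independent of $\varphi$, the probability (over $\varphi$, $y$ and the randomness of $\mathcal A$) that $\mathcal A^{\varphi,\varphi^{-1}}(y)$ outputs a message $m$ of at most $l$ blocks with $\mathsf{Sp}^{\varphi}(m)=y$ is at most $C\,q^4\,n\,2^{-\min(r,c)}$. Consequently, for every constant $p>0$ there is $\kappa>0$, depending only on $p$, such that every such adversary with success probability at least $p$ (for some $l\le q$) has $q\ge\kappa\,(2^{\min(r,c)}/n)^{1/4}$. -/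

import Mathlib

namespace SpongeBounds

/-- Bit strings of length `k`, i.e. the set `{0,1}^k`. -/
abbrev Bits (k : ℕ) : Type := Fin k → Bool

/-- The all-zero string `0^k`. -/
def zeroBits (k : ℕ) : Bits k := fun _ => false

/-- Bitwise XOR. -/
def xorBits {k : ℕ} (x y : Bits k) : Bits k := fun i => xor (x i) (y i)

/-- The first `r` bits of a state. -/
def rate {r c : ℕ} (s : Bits (r + c)) : Bits r := fun i => s (Fin.castAdd c i)

/-- The last `c` bits of a state. -/
def capacity {r c : ℕ} (s : Bits (r + c)) : Bits c := fun i => s (Fin.natAdd r i)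

/-- One absorbing round: XOR the block `x` into the rate, then apply `φ` to the whole state. -/
def absorb {r c : ℕ} (φ : Equiv.Perm (Bits (r + c))) (s : Bits (r + c)) (x : Bits r) :
    Bits (r + c) :=
  φ (Fin.append (xorBits (rate s) x) (capacity s))

/-- The sponge `Sp^φ : ({0,1}^r)^* → {0,1}^r` with one round of squeezing: start from the state
`0^r ‖ 0^c`, absorb the blocks of the message one after the other, and output the rate.
A message is the list of its blocks. -/
def sponge {r c : ℕ} (φ : Equiv.Perm (Bits (r + c))) (m : List (Bits r)) : Bits r :=
  rate (m.foldl (absorb φ) (zeroBits (r + c)))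

/-- A classical, randomized, adaptive and computationally unbounded algorithm with oracle access
to a permutation of `X` and to its inverse, with outputs in `α`.  In each step it outputs a value
and halts, queries the permutation, queries the inverse, or samples internal randomness; how it
continues depends on the answer or on the sample. -/
inductive OracleAlg (X α : Type) : Type
  | done (a : α) : OracleAlg X α
  | query (x : X) (cont : X → OracleAlg X α) : OracleAlg X α
  | queryInv (y : X) (cont : X → OracleAlg X α) : OracleAlg X α
  | sample (p : PMF ℕ) (cont : ℕ → OracleAlg X α) : OracleAlg X α

namespace OracleAlg

variable {X α : Type}

/-- The algorithm makes at most `q` oracle queries in total (to the permutation and to its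
inverse together). -/
def MakesAtMost : OracleAlg X α → ℕ → Prop
  | done _, _ => True
  | query _ _, 0 => False
  | query _ cont, q + 1 => ∀ y, MakesAtMost (cont y) q
  | queryInv _ _, 0 => False
  | queryInv _ cont, q + 1 => ∀ x, MakesAtMost (cont x) q
  | sample _ cont, q => ∀ i, MakesAtMost (cont i) q

/-- The distribution of the output when the oracles are `φ` and `φ⁻¹`. -/
noncomputable def run (φ : Equiv.Perm X) : OracleAlg X α → PMF α
  | done a => PMF.pure a
  | query x cont => run φ (cont (φ x))
  | queryInv y cont => run φ (cont (φ.symm y))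
  | sample p cont => p.bind fun i => run φ (cont i)

end OracleAlg

/-- The collision experiment: sample a uniformly random permutation `φ` of `{0,1}^(r+c)`, and run
the adversary with oracles `φ`, `φ⁻¹`.  The outcome is `φ` with the output `(m, m')`. -/
noncomputable def collisionGame {r c : ℕ}
    (A : OracleAlg (Bits (r + c)) (List (Bits r) × List (Bits r))) :
    PMF (Equiv.Perm (Bits (r + c)) × (List (Bits r) × List (Bits r))) :=
  (PMF.uniformOfFintype (Equiv.Perm (Bits (r + c)))).bind fun φ =>
    (A.run φ).map fun out => (φ, out)

/-- The probability that the output is a pair of distinct messages of at most `l` blocks each with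
the same sponge value. -/
noncomputable def collisionProb {r c : ℕ} (l : ℕ)
    (A : OracleAlg (Bits (r + c)) (List (Bits r) × List (Bits r))) : ℝ :=
  ((collisionGame A).toOuterMeasure
    {w | w.2.1.length ≤ l ∧ w.2.2.length ≤ l ∧ w.2.1 ≠ w.2.2 ∧
      sponge w.1 w.2.1 = sponge w.1 w.2.2}).toReal

/-- The preimage experiment: sample independently a uniformly random permutation `φ` of
`{0,1}^(r+c)` and a uniformly random `y` in `{0,1}^r`, and run the adversary on input `y` with
oracles `φ`, `φ⁻¹`.  The outcome is `φ` and `y` with the output `m`. -/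
noncomputable def preimageGame {r c : ℕ}
    (A : Bits r → OracleAlg (Bits (r + c)) (List (Bits r))) :
    PMF (Equiv.Perm (Bits (r + c)) × Bits r × List (Bits r)) :=
  (PMF.uniformOfFintype (Equiv.Perm (Bits (r + c)))).bind fun φ =>
    (PMF.uniformOfFintype (Bits r)).bind fun y =>
      ((A y).run φ).map fun m => (φ, y, m)

/-- The probability that the output is a message of at most `l` blocks whose sponge value is the
given `y`. -/
noncomputable def preimageProb {r c : ℕ} (l : ℕ)
    (A : Bits r → OracleAlg (Bits (r + c)) (List (Bits r))) : ℝ :=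
  ((preimageGame A).toOuterMeasure
    {w | w.2.2.length ≤ l ∧ sponge w.1 w.2.2 = w.2.1}).toReal

end SpongeBounds

namespace SpongeBounds

open scoped ENNReal

variable {r c : ℕ}

/-! The permutation is sampled lazily: at each moment only a table `L` of known pairs is fixed, and
`φ` is uniform among the permutations agreeing with `L`. The table is kept `Clean`: states reached
by different messages differ in rate and in capacity, and no nonempty message reaches the target
rate `t`. A clean table containing the evaluations of the output messages allows no collision, and
no nonempty preimage of `t`.

A forward query keeps the table clean if its answer has a fresh capacity and a fresh rate
(`Clean.cons_of_output_fresh`); an inverse query does so if its answer has a fresh capacity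
(`Clean.cons_of_input_fresh`). By symmetry an unknown answer is uniform over the unused values, so
with at most `Q` queries, `2 * Q ≤ 2 ^ (r + c)`, each one fails with probability at most `8 * Q / 2
^ min r c`.

Evaluating the output costs at most `2 * l` further queries. Hence `Q = 3 * q` suffices and the
total error is `72 * q ^ 2 / 2 ^ min r c`, stronger than claimed. The preimage game adds `2 ^ (-r)`
for the target `0^r`, which the empty message hits. If `6 * q > 2 ^ (r + c)`, the claimed bound
exceeds 1. -/

theorem rate_append (a : Bits r) (b : Bits c) : rate (Fin.append a b) = a := by
  funext i; simp [rate]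

theorem capacity_append (a : Bits r) (b : Bits c) : capacity (Fin.append a b) = b := by
  funext i; simp [capacity]

theorem append_rate_capacity (s : Bits (r + c)) : Fin.append (rate s) (capacity s) = s := by
  funext i
  refine Fin.addCases (fun j => ?_) (fun j => ?_) i <;> simp [rate, capacity]

theorem xorBits_left_cancel {k : ℕ} {a x y : Bits k} (h : xorBits a x = xorBits a y) : x = y := by
  funext i
  have := congrFun h i
  simpa [xorBits] using this

/-! ### Reachable states and clean tables -/

/-- `Reach L m s`: the table `L` of input-output pairs suffices to absorb the message `m`, and the
resulting state is `s`. -/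
inductive Reach (L : List (Bits (r + c) × Bits (r + c))) : List (Bits r) → Bits (r + c) → Prop
  | nil : Reach L [] (zeroBits (r + c))
  | snoc {m : List (Bits r)} {s t : Bits (r + c)} {b : Bits r} (h : Reach L m s)
      (hmem : (Fin.append (xorBits (rate s) b) (capacity s), t) ∈ L) : Reach L (m ++ [b]) t

namespace Reach

variable {L L' : List (Bits (r + c) × Bits (r + c))} {m : List (Bits r)} {s : Bits (r + c)}

theorem mono (hL : L ⊆ L') (h : Reach L m s) : Reach L' m s := by
  induction h with
  | nil => exact .nil
  | snoc _ hmem ih => exact .snoc ih (hL hmem)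

/-- Transfers facts about a table to the sponge values of every permutation agreeing with it. -/
theorem eq_foldl {φ : Equiv.Perm (Bits (r + c))} (hφ : ∀ e ∈ L, φ e.1 = e.2) (h : Reach L m s) :
    m.foldl (absorb φ) (zeroBits (r + c)) = s := by
  induction h with
  | nil => rfl
  | snoc _ hmem ih =>
    rw [List.foldl_append, ih]
    exact hφ _ hmem

theorem eq_zero_or_mem (h : Reach L m s) :
    (m = [] ∧ s = zeroBits (r + c)) ∨ ∃ x, (x, s) ∈ L := by
  cases h with
  | nil => exact Or.inl ⟨rfl, rfl⟩
  | snoc _ hmem => exact Or.inr ⟨_, hmem⟩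

end Reach

/-- The states reached in the table `L` by different messages differ both in rate and in capacity,
and no nonempty message is mapped to `t`. -/
structure Clean (t : Bits r) (L : List (Bits (r + c) × Bits (r + c))) : Prop where
  inj : ∀ {m m' s s'}, Reach L m s → Reach L m' s' →
    rate s = rate s' ∨ capacity s = capacity s' → m = m' ∧ s = s'
  rate_ne : ∀ {m s}, Reach L m s → m ≠ [] → rate s ≠ t

theorem clean_nil (t : Bits r) : Clean t ([] : List (Bits (r + c) × Bits (r + c))) := by
  have key : ∀ {m s}, Reach ([] : List (Bits (r + c) × Bits (r + c))) m s →
      m = [] ∧ s = zeroBits (r + c) := by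
    intro m s h
    simpa using h.eq_zero_or_mem
  refine ⟨fun h h' _ => ?_, fun h hm => absurd (key h).1 hm⟩
  rw [(key h).1, (key h).2, (key h').1, (key h').2]
  exact ⟨rfl, rfl⟩

/-! ### Fresh answers keep a table clean -/

/-- The capacities occurring in a table, together with `0^c`. -/
def seenCapacities (L : List (Bits (r + c) × Bits (r + c))) : Finset (Bits c) :=
  insert (zeroBits c)
    ((L.map fun e => capacity e.1).toFinset ∪ (L.map fun e => capacity e.2).toFinset)

/-- The rates of the outputs in a table, together with `0^r` and `t`. -/
def seenRates (t : Bits r) (L : List (Bits (r + c) × Bits (r + c))) : Finset (Bits r) :=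
  insert (zeroBits r) (insert t (L.map fun e => rate e.2).toFinset)

theorem card_seenCapacities_le (L : List (Bits (r + c) × Bits (r + c))) :
    (seenCapacities L).card ≤ 2 * L.length + 1 := by
  refine (Finset.card_insert_le _ _).trans ?_
  have h := Finset.card_union_le (L.map fun e => capacity e.1).toFinset
    (L.map fun e => capacity e.2).toFinset
  have h1 := List.toFinset_card_le (L.map fun e => capacity e.1)
  have h2 := List.toFinset_card_le (L.map fun e => capacity e.2)
  rw [List.length_map] at h1 h2
  omega

theorem card_seenRates_le (t : Bits r) (L : List (Bits (r + c) × Bits (r + c))) :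
    (seenRates t L).card ≤ L.length + 2 := by
  refine (Finset.card_insert_le _ _).trans ?_
  have h := Finset.card_insert_le t (L.map fun e => rate e.2).toFinset
  have h1 := List.toFinset_card_le (L.map fun e => rate e.2)
  rw [List.length_map] at h1
  omega

theorem zero_mem_seenCapacities (L : List (Bits (r + c) × Bits (r + c))) :
    zeroBits c ∈ seenCapacities L := Finset.mem_insert_self _ _

theorem capacity_fst_mem_seenCapacities {L : List (Bits (r + c) × Bits (r + c))}
    {e : Bits (r + c) × Bits (r + c)} (h : e ∈ L) : capacity e.1 ∈ seenCapacities L :=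
  Finset.mem_insert_of_mem (Finset.mem_union_left _
    (List.mem_toFinset.2 (List.mem_map.2 ⟨e, h, rfl⟩)))

theorem capacity_snd_mem_seenCapacities {L : List (Bits (r + c) × Bits (r + c))}
    {e : Bits (r + c) × Bits (r + c)} (h : e ∈ L) : capacity e.2 ∈ seenCapacities L :=
  Finset.mem_insert_of_mem (Finset.mem_union_right _
    (List.mem_toFinset.2 (List.mem_map.2 ⟨e, h, rfl⟩)))

theorem rate_snd_mem_seenRates (t : Bits r) {L : List (Bits (r + c) × Bits (r + c))}
    {e : Bits (r + c) × Bits (r + c)} (h : e ∈ L) : rate e.2 ∈ seenRates t L :=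
  Finset.mem_insert_of_mem (Finset.mem_insert_of_mem
    (List.mem_toFinset.2 (List.mem_map.2 ⟨e, h, rfl⟩)))

theorem Reach.capacity_mem {L : List (Bits (r + c) × Bits (r + c))} {m : List (Bits r)}
    {s : Bits (r + c)} (h : Reach L m s) : capacity s ∈ seenCapacities L := by
  rcases h.eq_zero_or_mem with ⟨-, rfl⟩ | ⟨x, hx⟩
  · exact zero_mem_seenCapacities L
  · exact capacity_snd_mem_seenCapacities hx

theorem Reach.rate_mem (t : Bits r) {L : List (Bits (r + c) × Bits (r + c))} {m : List (Bits r)}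
    {s : Bits (r + c)} (h : Reach L m s) : rate s ∈ seenRates t L := by
  rcases h.eq_zero_or_mem with ⟨-, rfl⟩ | ⟨x, hx⟩
  · exact Finset.mem_insert_self _ _
  · exact rate_snd_mem_seenRates t hx

/-- A new pair whose output has a fresh capacity can only be used in the last round. -/
theorem Reach.cons_cases {L : List (Bits (r + c) × Bits (r + c))} {x y : Bits (r + c)}
    (hy : capacity y ∉ insert (capacity x) (seenCapacities L)) {m : List (Bits r)}
    {s : Bits (r + c)} (h : Reach ((x, y) :: L) m s) :
    Reach L m s ∨ (s = y ∧ ∃ m₀ b s₀, Reach L m₀ s₀ ∧ m = m₀ ++ [b] ∧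
      x = Fin.append (xorBits (rate s₀) b) (capacity s₀)) := by
  simp only [Finset.mem_insert, not_or] at hy
  induction h with
  | nil => exact Or.inl .nil
  | @snoc m s u b _ hmem ih =>
    rcases ih with ih | ⟨rfl, -⟩
    · rcases List.mem_cons.1 hmem with heq | hmem
      · obtain ⟨h1, h2⟩ := Prod.mk.inj heq
        exact Or.inr ⟨h2, m, b, s, ih, rfl, h1.symm⟩
      · exact Or.inl (.snoc ih hmem)
    -- Absorbing a block keeps the capacity, so continuing from `y` needs a pair whose input has the
    -- capacity of `y`; freshness excludes both the new pair and the old ones.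
    · exfalso
      rcases List.mem_cons.1 hmem with heq | hmem
      · apply hy.1
        rw [← (Prod.mk.inj heq).1, capacity_append]
      · apply hy.2
        simpa [capacity_append] using capacity_fst_mem_seenCapacities hmem

/-- A new pair whose input has a fresh capacity is not used at all. -/
theorem Reach.of_cons {L : List (Bits (r + c) × Bits (r + c))} {x y : Bits (r + c)}
    (hx : capacity x ∉ seenCapacities L) {m : List (Bits r)}
    {s : Bits (r + c)} (h : Reach ((x, y) :: L) m s) : Reach L m s := by
  induction h with
  | nil => exact .nil
  | @snoc m s u b _ hmem ih =>
    rcases List.mem_cons.1 hmem with heq | hmem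
    · refine absurd ih.capacity_mem ?_
      rwa [← (Prod.mk.inj heq).1, capacity_append] at hx
    · exact .snoc ih hmem

/-- The new pair can only serve as a last round, so `y` is the only state that can be added. Its
rate and capacity clash with no old state, and its rate is not `t`. It remains to see that at most
one message arrives at `y`. -/
theorem Clean.cons_of_output_fresh {t : Bits r} {L : List (Bits (r + c) × Bits (r + c))}
    (hL : Clean t L) {x y : Bits (r + c)}
    (hc : capacity y ∉ insert (capacity x) (seenCapacities L)) (hr : rate y ∉ seenRates t L) :
    Clean t ((x, y) :: L) := by
  have hc' : capacity y ∉ seenCapacities L := fun h => hc (Finset.mem_insert_of_mem h)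
  have fresh : ∀ {m s}, Reach L m s → ¬ (rate s = rate y ∨ capacity s = capacity y) := by
    rintro m s h (he | he)
    · exact hr (he ▸ h.rate_mem t)
    · exact hc' (he ▸ h.capacity_mem)
  constructor
  · intro m m' s s' h h' he
    rcases h.cons_cases hc with h₁ | ⟨rfl, m₀, b, s₀, h₁, rfl, hx⟩ <;>
      rcases h'.cons_cases hc with h₂ | ⟨rfl, m₀', b', s₀', h₂, rfl, hx'⟩
    · exact hL.inj h₁ h₂ he
    · exact absurd he (fresh h₁)
    · exact absurd (he.imp Eq.symm Eq.symm) (fresh h₂)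
    -- Both predecessors have the capacity of `x`, so they coincide by cleanness of `L`, and then
    -- the rate of `x` determines the last block.
    · have hcap : capacity s₀ = capacity s₀' := by
        rw [← capacity_append (xorBits (rate s₀) b) (capacity s₀), ← hx, hx', capacity_append]
      obtain ⟨rfl, rfl⟩ := hL.inj h₁ h₂ (Or.inr hcap)
      have hrate : xorBits (rate s₀) b = xorBits (rate s₀) b' := by
        rw [← rate_append (xorBits (rate s₀) b) (capacity s₀), ← hx, hx', rate_append]
      rw [xorBits_left_cancel hrate]
      exact ⟨rfl, rfl⟩
  · intro m s h hm
    rcases h.cons_cases hc with h | ⟨rfl, -⟩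
    · exact hL.rate_ne h hm
    · rintro rfl
      exact hr (Finset.mem_insert_of_mem (Finset.mem_insert_self _ _))

/-- No reached state has the capacity of `x`, so no message can feed `x` to the permutation. This
handles inverse queries, where `y` is chosen by the adversary and need not be fresh. -/
theorem Clean.cons_of_input_fresh {t : Bits r} {L : List (Bits (r + c) × Bits (r + c))}
    (hL : Clean t L) {x y : Bits (r + c)} (hx : capacity x ∉ seenCapacities L) :
    Clean t ((x, y) :: L) :=
  ⟨fun h h' he => hL.inj (h.of_cons hx) (h'.of_cons hx) he,
    fun h hm => hL.rate_ne (h.of_cons hx) hm⟩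

theorem card_filter_capacity_le (F : Finset (Bits c)) :
    (Finset.univ.filter fun s : Bits (r + c) => capacity s ∈ F).card ≤ F.card * 2 ^ r := by
  have h : (F ×ˢ (Finset.univ : Finset (Bits r))).card = F.card * 2 ^ r := by
    simp [Finset.card_product]
  rw [← h]
  refine Finset.card_le_card_of_injOn (fun s => (capacity s, rate s)) ?_ ?_
  · intro s hs
    simpa using hs
  · intro s _ s' _ he
    rw [← append_rate_capacity s, ← append_rate_capacity s', (Prod.mk.inj he).1,
      (Prod.mk.inj he).2]

theorem card_filter_rate_le (F : Finset (Bits r)) :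
    (Finset.univ.filter fun s : Bits (r + c) => rate s ∈ F).card ≤ F.card * 2 ^ c := by
  have h : (F ×ˢ (Finset.univ : Finset (Bits c))).card = F.card * 2 ^ c := by
    simp [Finset.card_product]
  rw [← h]
  refine Finset.card_le_card_of_injOn (fun s => (rate s, capacity s)) ?_ ?_
  · intro s hs
    simpa using hs
  · intro s _ s' _ he
    rw [← append_rate_capacity s, ← append_rate_capacity s', (Prod.mk.inj he).1,
      (Prod.mk.inj he).2]

/-! ### Uniformity of unknown answers and conditional averages -/

section Perm

variable {X : Type} [Fintype X] [DecidableEq X]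

/-- The permutations that agree with a table. -/
def compat (L : List (X × X)) : Finset (Equiv.Perm X) :=
  Finset.univ.filter fun φ => ∀ e ∈ L, φ e.1 = e.2

theorem mem_compat {L : List (X × X)} {φ : Equiv.Perm X} :
    φ ∈ compat L ↔ ∀ e ∈ L, φ e.1 = e.2 := by
  simp [compat]

/-- If `f` takes all values outside `R` equally often on `Φ`, and no value in `R`, then it takes
values in `S` with frequency at most `|S| / (|X| - |R|)`. -/
theorem card_filter_mem_mul_le {ι : Type} (Φ : Finset ι) (f : ι → X) (R S : Finset X)
    (hR : ∀ φ ∈ Φ, f φ ∉ R)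
    (hsymm : ∀ y ∉ R, ∀ y' ∉ R, (Φ.filter fun φ => f φ = y).card ≤
      (Φ.filter fun φ => f φ = y').card) :
    (Fintype.card X - R.card) * (Φ.filter fun φ => f φ ∈ S).card ≤ S.card * Φ.card := by
  have hle : ∀ y, (Fintype.card X - R.card) * (Φ.filter fun φ => f φ = y).card ≤ Φ.card := by
    intro y
    by_cases hy : y ∈ R
    · have hempty : (Φ.filter fun φ => f φ = y) = ∅ :=
        Finset.filter_eq_empty_iff.2 fun φ hφ h => hR φ hφ (h.symm ▸ hy)
      simp [hempty]
    -- By symmetry each fibre over `Rᶜ` is at least as large as the one over `y`, and these fibres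
    -- partition `Φ`.
    · rw [← Finset.card_compl, ← smul_eq_mul]
      refine (Finset.card_nsmul_le_sum Rᶜ (fun y' => (Φ.filter fun φ => f φ = y').card) _
        fun y' hy' => hsymm y hy y' (Finset.mem_compl.1 hy')).trans ?_
      rw [Finset.card_eq_sum_card_fiberwise (f := f) (t := Rᶜ)
        fun φ hφ => Finset.mem_coe.2 (Finset.mem_compl.2 (hR φ hφ))]
  have hsum : (Φ.filter fun φ => f φ ∈ S).card = ∑ y ∈ S, (Φ.filter fun φ => f φ = y).card := by
    rw [Finset.card_eq_sum_card_fiberwise (f := f) (t := S)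
      fun φ hφ => Finset.mem_coe.2 (Finset.mem_filter.1 hφ).2]
    refine Finset.sum_congr rfl fun y hy => congrArg _ ?_
    ext φ
    simp only [Finset.mem_filter]
    constructor
    · rintro ⟨⟨h1, -⟩, h2⟩
      exact ⟨h1, h2⟩
    · rintro ⟨h1, h2⟩
      exact ⟨⟨h1, h2 ▸ hy⟩, h2⟩
  rw [hsum, Finset.mul_sum, ← smul_eq_mul]
  exact Finset.sum_le_card_nsmul _ _ _ fun y _ => hle y

/-- Composing on the left with the transposition of two unused outputs preserves agreement with `L`
and exchanges the corresponding values at `x`. -/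
theorem card_compat_apply_mem_mul_le (L : List (X × X)) (x : X) (hx : ∀ e ∈ L, e.1 ≠ x)
    (S : Finset X) :
    (Fintype.card X - L.length) * ((compat L).filter fun φ => φ x ∈ S).card ≤
      S.card * (compat L).card := by
  set R : Finset X := (L.map Prod.snd).toFinset with hRdef
  have hmemR : ∀ {y}, y ∈ R ↔ ∃ e ∈ L, e.2 = y := by
    intro y; simp [hRdef]
  have hRcard : R.card ≤ L.length := (List.toFinset_card_le _).trans (by simp)
  refine (Nat.mul_le_mul_right _ (Nat.sub_le_sub_left hRcard _)).trans
    (card_filter_mem_mul_le (compat L) (fun φ => φ x) R S ?_ ?_)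
  · intro φ hφ h
    obtain ⟨e, he, h⟩ := hmemR.1 h
    exact hx e he (φ.injective ((mem_compat.1 hφ e he).trans h))
  · intro y hy y' hy'
    refine Finset.card_le_card_of_injOn (fun φ => Equiv.swap y y' * φ) ?_
      (fun _ _ _ _ h => mul_left_cancel h)
    intro φ hφ
    obtain ⟨hφ, hφx⟩ := Finset.mem_filter.1 hφ
    refine Finset.mem_filter.2 ⟨mem_compat.2 fun e he => ?_, ?_⟩
    · rw [Equiv.Perm.mul_apply, mem_compat.1 hφ e he]
      exact Equiv.swap_apply_of_ne_of_ne (fun h => hy (hmemR.2 ⟨e, he, h⟩))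
        (fun h => hy' (hmemR.2 ⟨e, he, h⟩))
    · rw [Equiv.Perm.mul_apply, hφx, Equiv.swap_apply_left]

/-- The same argument, with transpositions of unused inputs composed on the right. -/
theorem card_compat_symm_apply_mem_mul_le (L : List (X × X)) (y : X) (hy : ∀ e ∈ L, e.2 ≠ y)
    (S : Finset X) :
    (Fintype.card X - L.length) * ((compat L).filter fun φ => φ.symm y ∈ S).card ≤
      S.card * (compat L).card := by
  set R : Finset X := (L.map Prod.fst).toFinset with hRdef
  have hmemR : ∀ {x}, x ∈ R ↔ ∃ e ∈ L, e.1 = x := by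
    intro y; simp [hRdef]
  have hRcard : R.card ≤ L.length := (List.toFinset_card_le _).trans (by simp)
  refine (Nat.mul_le_mul_right _ (Nat.sub_le_sub_left hRcard _)).trans
    (card_filter_mem_mul_le (compat L) (fun φ => φ.symm y) R S ?_ ?_)
  · intro φ hφ h
    obtain ⟨e, he, h⟩ := hmemR.1 h
    refine hy e he ?_
    rw [← mem_compat.1 hφ e he, h, Equiv.apply_symm_apply]
  · intro x hx x' hx'
    refine Finset.card_le_card_of_injOn (fun φ => φ * Equiv.swap x x') ?_
      (fun _ _ _ _ h => mul_right_cancel h)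
    intro φ hφ
    obtain ⟨hφ, hφx⟩ := Finset.mem_filter.1 hφ
    refine Finset.mem_filter.2 ⟨mem_compat.2 fun e he => ?_, ?_⟩
    · rw [Equiv.Perm.mul_apply, Equiv.swap_apply_of_ne_of_ne (fun h => hx (hmemR.2 ⟨e, he, h⟩))
        (fun h => hx' (hmemR.2 ⟨e, he, h⟩)), mem_compat.1 hφ e he]
    · rw [Equiv.symm_apply_eq, Equiv.Perm.mul_apply, Equiv.swap_apply_right]
      exact (Equiv.symm_apply_eq φ).1 hφx

/-- The average of `W` over the permutations that agree with `L` is at most `B`. -/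
def AvgBound (L : List (X × X)) (W : Equiv.Perm X → ℝ≥0∞) (B : ℝ≥0∞) : Prop :=
  ∑ φ ∈ compat L, W φ ≤ (compat L).card * B

theorem AvgBound.mono {L : List (X × X)} {W : Equiv.Perm X → ℝ≥0∞} {B B' : ℝ≥0∞}
    (h : AvgBound L W B) (hB : B ≤ B') : AvgBound L W B' :=
  le_trans h (by gcongr)

/-- Averaging over the value of `f`, whose bad values `S` have frequency at most `ε`. -/
theorem avgBound_of_fiberwise {L : List (X × X)} {W : Equiv.Perm X → ℝ≥0∞} {B ε : ℝ≥0∞}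
    (hW : ∀ φ, W φ ≤ 1) (f : Equiv.Perm X → X) (S : Finset X) (T : X → List (X × X))
    (hT : ∀ y, compat (T y) = (compat L).filter fun φ => f φ = y)
    (hS : (((compat L).filter fun φ => f φ ∈ S).card : ℝ≥0∞) ≤ (compat L).card * ε)
    (hB : ∀ y ∉ S, AvgBound (T y) W B) : AvgBound L W (B + ε) := by
  unfold AvgBound
  -- Good values are averaged fibre by fibre using `hB`; on bad values `W ≤ 1` is enough.
  rw [← Finset.sum_filter_add_sum_filter_not (compat L) (fun φ => f φ ∈ S), add_comm, mul_add]
  refine add_le_add ?_ ?_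
  · rw [← Finset.sum_fiberwise_of_maps_to (t := Sᶜ) (g := f)
      fun φ hφ => Finset.mem_compl.2 (Finset.mem_filter.1 hφ).2]
    calc ∑ y ∈ Sᶜ, ∑ φ ∈ (compat L).filter (fun φ => f φ ∉ S) with f φ = y, W φ
        ≤ ∑ y ∈ Sᶜ, ((compat (T y)).card : ℝ≥0∞) * B := by
          refine Finset.sum_le_sum fun y hy => ?_
          refine le_trans (Finset.sum_le_sum_of_subset ?_) (hB y (Finset.mem_compl.1 hy))
          rw [hT]
          exact Finset.filter_subset_filter _ (Finset.filter_subset _ _)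
      _ ≤ (compat L).card * B := by
          rw [← Finset.sum_mul, ← Nat.cast_sum]
          gcongr
          rw [Finset.card_eq_sum_card_fiberwise (s := compat L) (f := f) (t := Finset.univ)
            fun φ _ => by simp]
          simp only [hT]
          exact Finset.sum_le_sum_of_subset (Finset.subset_univ _)
  · refine le_trans (Finset.sum_le_sum fun φ _ => hW φ) ?_
    simpa using hS

theorem avgBound_tsum {L : List (X × X)} (p : PMF ℕ) {W : ℕ → Equiv.Perm X → ℝ≥0∞} {B : ℝ≥0∞}
    (h : ∀ i, AvgBound L (W i) B) : AvgBound L (fun φ => ∑' i, p i * W i φ) B := by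
  unfold AvgBound
  rw [← Summable.tsum_finsetSum fun _ _ => ENNReal.summable]
  calc ∑' i, ∑ φ ∈ compat L, p i * W i φ ≤ ∑' i, p i * ((compat L).card * B) := by
        refine ENNReal.tsum_le_tsum fun i => ?_
        rw [← Finset.mul_sum]
        exact mul_le_mul_right (h i) _
    _ = (compat L).card * B := by rw [ENNReal.tsum_mul_right, p.tsum_coe, one_mul]

theorem compat_cons (L : List (X × X)) (x y : X) :
    compat ((x, y) :: L) = (compat L).filter fun φ => φ x = y := by
  ext φ
  simp [mem_compat, and_comm]

theorem compat_cons_symm (L : List (X × X)) (x y : X) :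
    compat ((x, y) :: L) = (compat L).filter fun φ => φ.symm y = x := by
  rw [compat_cons]
  refine Finset.filter_congr fun φ _ => ?_
  rw [Equiv.symm_apply_eq, eq_comm]

end Perm

/-! ### The error of a single query -/

/-- Bound on the probability that one of `Q` queries leads to an unwanted coincidence. -/
noncomputable def stepError (r c Q : ℕ) : ℝ≥0∞ := ((8 * Q : ℕ) : ℝ≥0∞) / ((2 ^ min r c : ℕ) : ℝ≥0∞)

theorem mul_stepError_ne_top (r c Q : ℕ) : (Q : ℝ≥0∞) * stepError r c Q ≠ ∞ :=
  ENNReal.mul_ne_top (ENNReal.natCast_ne_top _)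
    (ENNReal.div_ne_top (ENNReal.natCast_ne_top _) (by simp))

/-- The bad set is at most a fraction `(3 * ℓ + 4) / 2 ^ min r c ≤ 4 * Q / 2 ^ min r c` of all
states. At least half of the states are still available as answers, which doubles 4 to 8. -/
theorem card_le_mul_stepError {Q ℓ k K s : ℕ} (hQ : 2 * Q ≤ 2 ^ (r + c)) (hℓ : ℓ < Q)
    (h : (2 ^ (r + c) - ℓ) * k ≤ s * K)
    (hs : s ≤ (2 * ℓ + 2) * 2 ^ r + (ℓ + 2) * 2 ^ c) :
    (k : ℝ≥0∞) ≤ K * stepError r c Q := by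
  have h1 : s * 2 ^ min r c ≤ 4 * Q * 2 ^ (r + c) := by
    have hr : 2 ^ r * 2 ^ min r c ≤ 2 ^ (r + c) := by
      rw [pow_add]; gcongr <;> simp
    have hc : 2 ^ c * 2 ^ min r c ≤ 2 ^ (r + c) := by
      rw [pow_add, mul_comm (2 ^ r)]; gcongr <;> simp
    calc s * 2 ^ min r c ≤ ((2 * ℓ + 2) * 2 ^ r + (ℓ + 2) * 2 ^ c) * 2 ^ min r c := by gcongr
      _ = (2 * ℓ + 2) * (2 ^ r * 2 ^ min r c) + (ℓ + 2) * (2 ^ c * 2 ^ min r c) := by ring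
      _ ≤ (2 * ℓ + 2) * 2 ^ (r + c) + (ℓ + 2) * 2 ^ (r + c) := by gcongr
      _ = (3 * ℓ + 4) * 2 ^ (r + c) := by ring
      _ ≤ 4 * Q * 2 ^ (r + c) := by gcongr; omega
  have h2 : 2 ^ (r + c) ≤ 2 * (2 ^ (r + c) - ℓ) := by omega
  have hpos : 0 < 2 ^ (r + c) - ℓ := by omega
  have h3 : k * 2 ^ min r c ≤ K * (8 * Q) := by
    refine Nat.le_of_mul_le_mul_left ?_ hpos
    calc (2 ^ (r + c) - ℓ) * (k * 2 ^ min r c) = ((2 ^ (r + c) - ℓ) * k) * 2 ^ min r c := by ring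
      _ ≤ s * K * 2 ^ min r c := by gcongr
      _ = K * (s * 2 ^ min r c) := by ring
      _ ≤ K * (4 * Q * (2 * (2 ^ (r + c) - ℓ))) := by
        refine Nat.mul_le_mul_left _ (h1.trans ?_)
        gcongr
      _ = (2 ^ (r + c) - ℓ) * (K * (8 * Q)) := by ring
  unfold stepError
  rw [← mul_div_assoc, ENNReal.le_div_iff_mul_le (by simp) (by simp)]
  exact_mod_cast h3

/-! ### Running an algorithm on a clean table -/

section Query

variable {t : Bits r} {L : List (Bits (r + c) × Bits (r + c))}
  {W : Equiv.Perm (Bits (r + c)) → ℝ≥0∞} {B : ℝ≥0∞} {Q : ℕ}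

theorem avgBound_query (hQ : 2 * Q ≤ 2 ^ (r + c)) (hL : Clean t L) (hlen : L.length < Q)
    (hW : ∀ φ, W φ ≤ 1) (x : Bits (r + c))
    (hB : ∀ y L', Clean t L' → L ⊆ L' → L'.length ≤ L.length + 1 → (x, y) ∈ L' →
      AvgBound L' W B) :
    AvgBound L W (B + stepError r c Q) := by
  by_cases hx : ∃ e ∈ L, e.1 = x
  · obtain ⟨⟨x, y⟩, he, rfl⟩ := hx
    exact (hB y L hL (List.Subset.refl L) (Nat.le_succ _) he).mono le_self_add
  · push Not at hx
    set S : Finset (Bits (r + c)) :=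
      (Finset.univ.filter fun y => capacity y ∈ insert (capacity x) (seenCapacities L)) ∪
        (Finset.univ.filter fun y => rate y ∈ seenRates t L) with hS
    have hScard : S.card ≤ (2 * L.length + 2) * 2 ^ r + (L.length + 2) * 2 ^ c := by
      refine (Finset.card_union_le _ _).trans (add_le_add ?_ ?_)
      · refine (card_filter_capacity_le _).trans (Nat.mul_le_mul_right _ ?_)
        exact (Finset.card_insert_le _ _).trans
          (Nat.succ_le_succ (card_seenCapacities_le L))
      · exact (card_filter_rate_le _).trans (Nat.mul_le_mul_right _ (card_seenRates_le t L))
    have hcard := card_compat_apply_mem_mul_le L x hx S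
    rw [show Fintype.card (Bits (r + c)) = 2 ^ (r + c) by simp] at hcard
    refine avgBound_of_fiberwise hW (fun φ => φ x) S (fun y => (x, y) :: L)
      (fun y => compat_cons L x y) (card_le_mul_stepError hQ hlen hcard hScard) fun y hy => ?_
    rw [hS, Finset.mem_union, not_or] at hy
    exact hB y _ (hL.cons_of_output_fresh (by simpa using hy.1) (by simpa using hy.2))
      (List.subset_cons_self _ _) (by simp) (by simp)

theorem avgBound_queryInv (hQ : 2 * Q ≤ 2 ^ (r + c)) (hL : Clean t L) (hlen : L.length < Q)
    (hW : ∀ φ, W φ ≤ 1) (y : Bits (r + c))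
    (hB : ∀ x L', Clean t L' → L ⊆ L' → L'.length ≤ L.length + 1 → (x, y) ∈ L' →
      AvgBound L' W B) :
    AvgBound L W (B + stepError r c Q) := by
  by_cases hy : ∃ e ∈ L, e.2 = y
  · obtain ⟨⟨x, y⟩, he, rfl⟩ := hy
    exact (hB x L hL (List.Subset.refl L) (Nat.le_succ _) he).mono le_self_add
  · push Not at hy
    set S : Finset (Bits (r + c)) :=
      Finset.univ.filter fun x => capacity x ∈ seenCapacities L with hS
    have hScard : S.card ≤ (2 * L.length + 2) * 2 ^ r + (L.length + 2) * 2 ^ c := by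
      refine le_add_right ((card_filter_capacity_le _).trans (Nat.mul_le_mul_right _ ?_))
      exact (card_seenCapacities_le L).trans (Nat.le_succ _)
    have hcard := card_compat_symm_apply_mem_mul_le L y hy S
    rw [show Fintype.card (Bits (r + c)) = 2 ^ (r + c) by simp] at hcard
    refine avgBound_of_fiberwise hW (fun φ => φ.symm y) S (fun x => (x, y) :: L)
      (fun x => compat_cons_symm L x y) (card_le_mul_stepError hQ hlen hcard hScard) fun x hx => ?_
    exact hB x _ (hL.cons_of_input_fresh (by simpa [hS] using hx))
      (List.subset_cons_self _ _) (by simp) (by simp)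

/-- Evaluating a message by queries to the permutation. -/
theorem avgBound_eval (hQ : 2 * Q ≤ 2 ^ (r + c)) (hW : ∀ φ, W φ ≤ 1) (m : List (Bits r)) :
    ∀ {L : List (Bits (r + c) × Bits (r + c))} {m₀ : List (Bits r)} {s₀ : Bits (r + c)},
      Clean t L → L.length + m.length ≤ Q → Reach L m₀ s₀ →
      (∀ s L', Clean t L' → L ⊆ L' → L'.length ≤ L.length + m.length → Reach L' (m₀ ++ m) s →
        AvgBound L' W B) →
      AvgBound L W (B + m.length * stepError r c Q) := by
  induction m with
  | nil =>
    intro L m₀ s₀ hL _ h₀ hB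
    simpa using hB s₀ L hL (List.Subset.refl L) (by simp) (by simpa using h₀)
  | cons b m ih =>
    intro L m₀ s₀ hL hlen h₀ hB
    rw [List.length_cons] at hlen
    rw [List.length_cons, Nat.cast_succ, add_mul, one_mul, ← add_assoc]
    refine avgBound_query hQ hL (by omega) hW
      (Fin.append (xorBits (rate s₀) b) (capacity s₀)) fun y L' hL' hsub hlen' hmem => ?_
    refine ih hL' (by omega) (.snoc (h₀.mono hsub) hmem) fun s L'' hL'' hsub' hlen'' h => ?_
    refine hB s L'' hL'' (List.Subset.trans hsub hsub') ?_ (by simpa using h)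
    rw [List.length_cons]
    omega

/-- An algorithm with `k` queries whose output wins, in a clean table, with probability at most
`B`. -/
theorem avgBound_run {α : Type} (hQ : 2 * Q ≤ 2 ^ (r + c)) {K : ℕ}
    (win : Equiv.Perm (Bits (r + c)) → Set α)
    (hdone : ∀ a {L : List (Bits (r + c) × Bits (r + c))}, Clean t L → L.length ≤ K →
      AvgBound L (fun φ => (PMF.pure a).toOuterMeasure (win φ)) B)
    (hK : K ≤ Q) (A : OracleAlg (Bits (r + c)) α) :
    ∀ {k : ℕ} {L : List (Bits (r + c) × Bits (r + c))}, A.MakesAtMost k → Clean t L →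
      L.length + k ≤ K →
      AvgBound L (fun φ => (A.run φ).toOuterMeasure (win φ)) (B + k * stepError r c Q) := by
  have hW : ∀ (A : OracleAlg (Bits (r + c)) α) (φ : Equiv.Perm (Bits (r + c))),
      (A.run φ).toOuterMeasure (win φ) ≤ 1 := fun A φ =>
    ((A.run φ).toOuterMeasure.mono (Set.subset_univ _)).trans
      (((A.run φ).toOuterMeasure_apply_eq_one_iff _).2 (Set.subset_univ _)).le
  -- Once a pair is in the table, the oracle's answer may be replaced by the recorded one.
  have hcongr : ∀ {L W W' B}, (∀ φ ∈ compat L, W φ = W' φ) →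
      AvgBound (X := Bits (r + c)) L W B → AvgBound L W' B := by
    intro L W W' B h h'
    unfold AvgBound at h' ⊢
    rwa [← Finset.sum_congr rfl h]
  induction A with
  | done a =>
    intro k L _ hL hlen
    exact (hdone a hL (by omega)).mono le_self_add
  | query x cont ih =>
    intro k L hA hL hlen
    cases k with
    | zero => exact hA.elim
    | succ k =>
      rw [Nat.cast_succ, add_mul, one_mul, ← add_assoc]
      refine avgBound_query hQ hL (by omega) (hW _) x fun y L' hL' _ hlen' hmem => ?_
      refine hcongr (fun φ hφ => ?_) (ih y (hA y) hL' (by omega))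
      change _ = ((cont (φ x)).run φ).toOuterMeasure (win φ)
      rw [show φ x = y from mem_compat.1 hφ _ hmem]
  | queryInv y cont ih =>
    intro k L hA hL hlen
    cases k with
    | zero => exact hA.elim
    | succ k =>
      rw [Nat.cast_succ, add_mul, one_mul, ← add_assoc]
      refine avgBound_queryInv hQ hL (by omega) (hW _) y fun x L' hL' _ hlen' hmem => ?_
      refine hcongr (fun φ hφ => ?_) (ih x (hA x) hL' (by omega))
      change _ = ((cont (φ.symm y)).run φ).toOuterMeasure (win φ)
      rw [show φ.symm y = x from (Equiv.symm_apply_eq φ).2 (mem_compat.1 hφ _ hmem).symm]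
  | sample p cont ih =>
    intro k L hA hL hlen
    refine hcongr (fun φ _ => ?_) (avgBound_tsum p fun i => ih i (k := k) (by
      cases k <;> exact hA i) hL hlen)
    exact (PMF.toOuterMeasure_bind_apply _ _ _).symm

end Query

/-! ### Checking the output -/

/-- The winning outputs of the collision game. -/
def collisionSet (l : ℕ) (φ : Equiv.Perm (Bits (r + c))) : Set (List (Bits r) × List (Bits r)) :=
  {w | w.1.length ≤ l ∧ w.2.length ≤ l ∧ w.1 ≠ w.2 ∧ sponge φ w.1 = sponge φ w.2}

/-- The winning outputs of the preimage game. -/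
def preimageSet (l : ℕ) (y : Bits r) (φ : Equiv.Perm (Bits (r + c))) : Set (List (Bits r)) :=
  {m | m.length ≤ l ∧ sponge φ m = y}

theorem pure_toOuterMeasure_le_one {α : Type} (a : α) (s : Set α) :
    (PMF.pure a).toOuterMeasure s ≤ 1 := by
  classical
  rw [PMF.toOuterMeasure_pure_apply]
  split_ifs <;> simp

theorem avgBound_zero_of_notMem {α : Type} {L : List (Bits (r + c) × Bits (r + c))} {a : α}
    {win : Equiv.Perm (Bits (r + c)) → Set α} (h : ∀ φ ∈ compat L, a ∉ win φ) :
    AvgBound L (fun φ => (PMF.pure a).toOuterMeasure (win φ)) 0 := by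
  classical
  unfold AvgBound
  rw [Finset.sum_eq_zero]
  · exact zero_le
  · intro φ hφ
    rw [PMF.toOuterMeasure_pure_apply, if_neg (h φ hφ)]

/-- Both messages are evaluated into the table at a cost of at most `2 * l` queries. If the table is
still clean, equal output rates force equal messages. -/
theorem avgBound_collision_output {Q K l : ℕ} (hQ : 2 * Q ≤ 2 ^ (r + c)) (hKQ : K + 2 * l ≤ Q)
    (t : Bits r) (a : List (Bits r) × List (Bits r)) {L : List (Bits (r + c) × Bits (r + c))}
    (hL : Clean t L) (hlen : L.length ≤ K) :
    AvgBound L (fun φ => (PMF.pure a).toOuterMeasure (collisionSet l φ))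
      ((2 * l : ℕ) * stepError r c Q) := by
  obtain ⟨m, m'⟩ := a
  by_cases hm : m.length ≤ l ∧ m'.length ≤ l ∧ m ≠ m'
  swap
  · refine (avgBound_zero_of_notMem fun φ _ h => hm ?_).mono zero_le
    exact ⟨h.1, h.2.1, h.2.2.1⟩
  obtain ⟨hml, hml', hne⟩ := hm
  have key : AvgBound L (fun φ => (PMF.pure (m, m')).toOuterMeasure (collisionSet l φ))
      (0 + m'.length * stepError r c Q + m.length * stepError r c Q) := by
    refine avgBound_eval (t := t) hQ (fun φ => pure_toOuterMeasure_le_one _ _) m hL (by omega)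
      .nil fun s L' hL' _ hlen' hs => ?_
    refine avgBound_eval (t := t) hQ (fun φ => pure_toOuterMeasure_le_one _ _) m' hL' (by omega)
      .nil fun s' L'' hL'' hsub _ hs' => ?_
    refine avgBound_zero_of_notMem fun φ hφ h => hne ?_
    have hs := hs.mono hsub
    rw [List.nil_append] at hs hs'
    refine (hL''.inj hs hs' (Or.inl ?_)).1
    rw [← hs.eq_foldl (mem_compat.1 hφ), ← hs'.eq_foldl (mem_compat.1 hφ)]
    exact h.2.2.2
  refine key.mono ?_
  rw [zero_add, ← add_mul, ← Nat.cast_add]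
  gcongr
  omega

theorem avgBound_preimage_output {Q K l : ℕ} (hQ : 2 * Q ≤ 2 ^ (r + c)) (hKQ : K + 2 * l ≤ Q)
    {y : Bits r} (hy : y ≠ zeroBits r) (m : List (Bits r))
    {L : List (Bits (r + c) × Bits (r + c))} (hL : Clean y L) (hlen : L.length ≤ K) :
    AvgBound L (fun φ => (PMF.pure m).toOuterMeasure (preimageSet l y φ))
      ((2 * l : ℕ) * stepError r c Q) := by
  by_cases hm : m.length ≤ l
  swap
  · exact (avgBound_zero_of_notMem fun φ _ h => hm h.1).mono zero_le
  have key : AvgBound L (fun φ => (PMF.pure m).toOuterMeasure (preimageSet l y φ))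
      (0 + m.length * stepError r c Q) := by
    refine avgBound_eval (t := y) hQ (fun φ => pure_toOuterMeasure_le_one _ _) m hL (by omega)
      .nil fun s L' hL' _ _ hs => ?_
    refine avgBound_zero_of_notMem fun φ hφ h => ?_
    rw [List.nil_append] at hs
    have hval : sponge φ m = y := h.2
    -- The empty message has value `0^r` and is not covered by cleanness; `hy` excludes it.
    refine hL'.rate_ne hs ?_ ?_
    · rintro rfl
      exact hy hval.symm
    · rw [← hs.eq_foldl (mem_compat.1 hφ)]
      exact hval
  refine key.mono ?_
  rw [zero_add]
  gcongr
  omega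

/-! ### From averages to the two games -/

/-- The average over all permutations as an expectation. -/
theorem AvgBound.tsum_uniform_le {X : Type} [Fintype X] [DecidableEq X]
    {W : Equiv.Perm X → ℝ≥0∞} {B : ℝ≥0∞} (h : AvgBound [] W B) :
    ∑' φ, PMF.uniformOfFintype (Equiv.Perm X) φ * W φ ≤ B := by
  have hc : compat ([] : List (X × X)) = Finset.univ := by
    ext φ; simp [mem_compat]
  unfold AvgBound at h
  rw [hc, Finset.card_univ] at h
  simp only [PMF.uniformOfFintype_apply]
  rw [tsum_fintype, ← Finset.mul_sum, mul_comm, ← div_eq_mul_inv]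
  exact ENNReal.div_le_of_le_mul' h

theorem collisionProb_le_mul_stepError {q l Q : ℕ} (hQ : 2 * Q ≤ 2 ^ (r + c))
    (hqQ : q + 2 * l ≤ Q) (A : OracleAlg (Bits (r + c)) (List (Bits r) × List (Bits r)))
    (hA : A.MakesAtMost q) :
    collisionProb l A ≤ ((Q : ℝ≥0∞) * stepError r c Q).toReal := by
  refine ENNReal.toReal_mono (mul_stepError_ne_top r c Q) ?_
  -- Collisions involve no target, so the choice of `t` is arbitrary.
  have h := avgBound_run (t := zeroBits r) hQ (collisionSet l)
    (fun a L hL hlen => avgBound_collision_output (K := q) hQ hqQ _ a hL hlen) (by omega) A hA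
    (clean_nil _) (by simp)
  rw [← add_mul, ← Nat.cast_add] at h
  refine le_trans ?_ ((h.mono (B' := Q * stepError r c Q) ?_).tsum_uniform_le)
  · rw [collisionGame, PMF.toOuterMeasure_bind_apply]
    refine ENNReal.tsum_le_tsum fun φ => ?_
    rw [PMF.toOuterMeasure_map_apply]
    exact le_rfl
  · gcongr
    omega

theorem preimageProb_le_mul_stepError {q l Q : ℕ} (hQ : 2 * Q ≤ 2 ^ (r + c))
    (hqQ : q + 2 * l ≤ Q) (A : Bits r → OracleAlg (Bits (r + c)) (List (Bits r)))
    (hA : ∀ y, (A y).MakesAtMost q) :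
    preimageProb l A ≤ ((Q : ℝ≥0∞) * stepError r c Q + ((2 ^ r : ℕ) : ℝ≥0∞)⁻¹).toReal := by
  refine ENNReal.toReal_mono (ENNReal.add_ne_top.2 ⟨mul_stepError_ne_top r c Q, by simp⟩) ?_
  have h : ∀ y : Bits r, y ≠ zeroBits r →
      ∑' φ, PMF.uniformOfFintype (Equiv.Perm (Bits (r + c))) φ *
        ((A y).run φ).toOuterMeasure (preimageSet l y φ) ≤ Q * stepError r c Q := by
    intro y hy
    have h := avgBound_run (t := y) hQ (preimageSet l y)
      (fun a L hL hlen => avgBound_preimage_output (K := q) hQ hqQ hy a hL hlen) (by omega) (A y)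
      (hA y) (clean_nil _) (by simp)
    rw [← add_mul, ← Nat.cast_add] at h
    refine (h.mono (B' := Q * stepError r c Q) ?_).tsum_uniform_le
    gcongr
    omega
  -- The target `0^r` is conceded to the adversary; it is drawn with probability `2 ^ (-r)`.
  have h' : ∀ y : Bits r, ∑' φ, PMF.uniformOfFintype (Equiv.Perm (Bits (r + c))) φ *
        ((A y).run φ).toOuterMeasure (preimageSet l y φ) ≤
      Q * stepError r c Q + if y = zeroBits r then 1 else 0 := by
    intro y
    split_ifs with hy
    · refine le_trans ?_ le_add_self
      rw [← (PMF.uniformOfFintype (Equiv.Perm (Bits (r + c)))).tsum_coe]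
      refine ENNReal.tsum_le_tsum fun φ => mul_le_of_le_one_right' ?_
      exact (((A y).run φ).toOuterMeasure.mono (Set.subset_univ _)).trans
        ((((A y).run φ).toOuterMeasure_apply_eq_one_iff _).2 (Set.subset_univ _)).le
    · rw [add_zero]
      exact h y hy
  calc (preimageGame A).toOuterMeasure {w | w.2.2.length ≤ l ∧ sponge w.1 w.2.2 = w.2.1}
      = ∑' φ, PMF.uniformOfFintype (Equiv.Perm (Bits (r + c))) φ *
          ∑' y, PMF.uniformOfFintype (Bits r) y *
            ((A y).run φ).toOuterMeasure (preimageSet l y φ) := by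
        rw [preimageGame, PMF.toOuterMeasure_bind_apply]
        refine tsum_congr fun φ => congrArg _ ?_
        rw [PMF.toOuterMeasure_bind_apply]
        refine tsum_congr fun y => congrArg _ ?_
        rw [PMF.toOuterMeasure_map_apply]
        rfl
    _ = ∑' y, PMF.uniformOfFintype (Bits r) y *
          ∑' φ, PMF.uniformOfFintype (Equiv.Perm (Bits (r + c))) φ *
            ((A y).run φ).toOuterMeasure (preimageSet l y φ) := by
        simp only [← ENNReal.tsum_mul_left]
        rw [ENNReal.tsum_comm]
        exact tsum_congr fun y => tsum_congr fun φ => mul_left_comm _ _ _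
    _ ≤ ∑' y, PMF.uniformOfFintype (Bits r) y *
          (Q * stepError r c Q + if y = zeroBits r then 1 else 0) :=
        ENNReal.tsum_le_tsum fun y => mul_le_mul_right (h' y) _
    _ = Q * stepError r c Q + ((2 ^ r : ℕ) : ℝ≥0∞)⁻¹ := by
        simp only [mul_add]
        rw [ENNReal.tsum_add, ENNReal.tsum_mul_right, PMF.tsum_coe, one_mul]
        congr 1
        rw [tsum_eq_single (zeroBits r) fun y hy => by rw [if_neg hy, mul_zero]]
        simp [PMF.uniformOfFintype_apply]

/-! ### Explicit constants -/

theorem toReal_mul_stepError (r c Q : ℕ) :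
    ((Q : ℝ≥0∞) * stepError r c Q).toReal = 8 * (Q : ℝ) ^ 2 / 2 ^ min r c := by
  rw [stepError, ENNReal.toReal_mul, ENNReal.toReal_div, ENNReal.toReal_natCast,
    ENNReal.toReal_natCast, ENNReal.toReal_natCast]
  push_cast
  ring

theorem toOuterMeasure_toReal_le_one {α : Type} (p : PMF α) (s : Set α) :
    (p.toOuterMeasure s).toReal ≤ 1 := by
  refine ENNReal.toReal_le_of_le_ofReal zero_le_one ?_
  rw [ENNReal.ofReal_one]
  exact (p.toOuterMeasure.mono (Set.subset_univ _)).trans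
    ((p.toOuterMeasure_apply_eq_one_iff _).2 (Set.subset_univ _)).le

/-- The claimed bound exceeds `1` once the number of queries is comparable to the number of
states. -/
theorem one_le_bound {q : ℕ} (hr : 1 ≤ r) (h : ¬ 2 * (3 * q) ≤ 2 ^ (r + c)) :
    1 ≤ 73 * ((q : ℝ) ^ 4 * ((r + c : ℕ) : ℝ) / 2 ^ min r c) := by
  have hq : 1 ≤ q := by
    by_contra hq
    apply h
    rw [show q = 0 by omega]
    simp
  have hmin : (2 : ℝ) ^ min r c ≤ 6 * q := by
    have : 2 ^ min r c ≤ 6 * q := by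
      have : 2 ^ min r c ≤ 2 ^ (r + c) := Nat.pow_le_pow_right (by norm_num) (by omega)
      omega
    exact_mod_cast this
  have hn : (1 : ℝ) ≤ ((r + c : ℕ) : ℝ) := by exact_mod_cast (by omega : 1 ≤ r + c)
  have hq' : (1 : ℝ) ≤ q := by exact_mod_cast hq
  have hq4 : (q : ℝ) ≤ (q : ℝ) ^ 4 := le_self_pow₀ hq' (by norm_num)
  rw [← mul_div_assoc, le_div_iff₀ (by positivity), one_mul]
  nlinarith [mul_le_mul hq4 hn zero_le_one (by positivity)]

/-- The budget is `3 * q` because `q + 2 * l ≤ 3 * q`, and `8 * 3 ^ 2 = 72`. Passing from `q ^ 2` to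
`q ^ 4 * n` only weakens the bound. -/
theorem sq_bound_le {q : ℕ} (hr : 1 ≤ r) :
    8 * ((3 * q : ℕ) : ℝ) ^ 2 / 2 ^ min r c ≤
      72 * ((q : ℝ) ^ 4 * ((r + c : ℕ) : ℝ) / 2 ^ min r c) := by
  have hn : (1 : ℝ) ≤ ((r + c : ℕ) : ℝ) := by exact_mod_cast (by omega : 1 ≤ r + c)
  have h2 : (q : ℝ) ^ 2 ≤ (q : ℝ) ^ 4 := by
    rcases Nat.eq_zero_or_pos q with rfl | hq
    · simp
    · exact pow_le_pow_right₀ (by exact_mod_cast hq) (by norm_num)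
  rw [← mul_div_assoc]
  refine div_le_div_of_nonneg_right ?_ (by positivity)
  have h3 := mul_le_mul h2 hn zero_le_one (by positivity)
  rw [Nat.cast_mul, Nat.cast_ofNat, mul_pow]
  linarith

theorem collisionProb_le {q l : ℕ} (hr : 1 ≤ r) (hl : l ≤ q)
    (A : OracleAlg (Bits (r + c)) (List (Bits r) × List (Bits r))) (hA : A.MakesAtMost q) :
    collisionProb l A ≤ 73 * ((q : ℝ) ^ 4 * ((r + c : ℕ) : ℝ) / 2 ^ min r c) := by
  by_cases hQ : 2 * (3 * q) ≤ 2 ^ (r + c)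
  · refine (collisionProb_le_mul_stepError hQ (by omega) A hA).trans ?_
    rw [toReal_mul_stepError]
    refine (sq_bound_le hr).trans ?_
    gcongr
    norm_num
  · exact (toOuterMeasure_toReal_le_one _ _).trans (one_le_bound hr hQ)

/-- Here 73 is 72 for the queries plus 1 for the conceded target; absorbing `2 ^ (-r)` into the
bound needs `q ≥ 1`. -/
theorem preimageProb_le {q l : ℕ} (hr : 1 ≤ r) (hq : 1 ≤ q) (hl : l ≤ q)
    (A : Bits r → OracleAlg (Bits (r + c)) (List (Bits r))) (hA : ∀ y, (A y).MakesAtMost q) :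
    preimageProb l A ≤ 73 * ((q : ℝ) ^ 4 * ((r + c : ℕ) : ℝ) / 2 ^ min r c) := by
  by_cases hQ : 2 * (3 * q) ≤ 2 ^ (r + c)
  · refine (preimageProb_le_mul_stepError hQ (by omega) A hA).trans ?_
    rw [ENNReal.toReal_add (mul_stepError_ne_top r c _) (by simp), toReal_mul_stepError]
    have h1 : (((2 ^ r : ℕ) : ℝ≥0∞)⁻¹).toReal ≤
        (q : ℝ) ^ 4 * ((r + c : ℕ) : ℝ) / 2 ^ min r c := by
      rw [ENNReal.toReal_inv, ENNReal.toReal_natCast, Nat.cast_pow, Nat.cast_ofNat,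
        inv_eq_one_div]
      have hn : (1 : ℝ) ≤ ((r + c : ℕ) : ℝ) := by exact_mod_cast (by omega : 1 ≤ r + c)
      have hq4 : (1 : ℝ) ≤ (q : ℝ) ^ 4 := one_le_pow₀ (by exact_mod_cast hq)
      have hpow : (2 : ℝ) ^ min r c ≤ 2 ^ r :=
        pow_le_pow_right₀ (by norm_num) (min_le_left _ _)
      refine div_le_div₀ (by positivity) ?_ (by positivity) hpow
      nlinarith
    linarith [sq_bound_le (c := c) (q := q) hr]
  · exact (toOuterMeasure_toReal_le_one _ _).trans (one_le_bound hr hQ)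

/-- From a probability bound of order `q⁴ n / 2^min(r,c)` to a lower bound on `q`. -/
theorem le_query_of_le_bound {C p P : ℝ} (hC : 0 < C) (hp : 0 < p) {q : ℕ} (hr : 1 ≤ r)
    (hP : P ≤ C * ((q : ℝ) ^ 4 * ((r + c : ℕ) : ℝ) / 2 ^ min r c)) (hpP : p ≤ P) :
    (p / C) ^ (1 / 4 : ℝ) * ((2 : ℝ) ^ min r c / ((r + c : ℕ) : ℝ)) ^ (1 / 4 : ℝ) ≤ (q : ℝ) := by
  have hn : (0 : ℝ) < ((r + c : ℕ) : ℝ) := by exact_mod_cast (by omega : 0 < r + c)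
  rw [← Real.mul_rpow (by positivity) (by positivity)]
  have h : p / C * (2 ^ min r c / ((r + c : ℕ) : ℝ)) ≤ (q : ℝ) ^ 4 := by
    have h := hpP.trans hP
    rw [← mul_div_assoc, le_div_iff₀ (by positivity)] at h
    rw [div_mul_div_comm, div_le_iff₀ (by positivity)]
    linarith
  calc (p / C * (2 ^ min r c / ((r + c : ℕ) : ℝ))) ^ (1 / 4 : ℝ)
      ≤ ((q : ℝ) ^ 4) ^ (1 / 4 : ℝ) := Real.rpow_le_rpow (by positivity) h (by norm_num)
    _ = q := by
        rw [← Real.rpow_natCast, ← Real.rpow_mul (by positivity)]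
        norm_num

end SpongeBounds

open SpongeBounds in
theorem mainTheorem6 :
    -- collision resistance: the bound, and the resulting query lower bound
    (∃ C : ℝ, 0 < C ∧ ∀ r c q l : ℕ, 1 ≤ r → 1 ≤ c → l ≤ q →
      ∀ A : OracleAlg (Bits (r + c)) (List (Bits r) × List (Bits r)), A.MakesAtMost q →
        collisionProb l A ≤ C * ((q : ℝ) ^ 4 * ((r + c : ℕ) : ℝ) / 2 ^ min r c)) ∧
    (∀ p : ℝ, 0 < p → ∃ κ : ℝ, 0 < κ ∧ ∀ r c q l : ℕ, 1 ≤ r → 1 ≤ c → l ≤ q →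
      ∀ A : OracleAlg (Bits (r + c)) (List (Bits r) × List (Bits r)), A.MakesAtMost q →
        p ≤ collisionProb l A →
          κ * ((2 : ℝ) ^ min r c / ((r + c : ℕ) : ℝ)) ^ (1 / 4 : ℝ) ≤ (q : ℝ)) ∧
    -- preimage resistance: the bound, and the resulting query lower bound
    (∃ C : ℝ, 0 < C ∧ ∀ r c q l : ℕ, 1 ≤ r → 1 ≤ c → 1 ≤ q → l ≤ q →
      ∀ A : Bits r → OracleAlg (Bits (r + c)) (List (Bits r)), (∀ y, (A y).MakesAtMost q) →
        preimageProb l A ≤ C * ((q : ℝ) ^ 4 * ((r + c : ℕ) : ℝ) / 2 ^ min r c)) ∧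
    (∀ p : ℝ, 0 < p → ∃ κ : ℝ, 0 < κ ∧ ∀ r c q l : ℕ, 1 ≤ r → 1 ≤ c → 1 ≤ q → l ≤ q →
      ∀ A : Bits r → OracleAlg (Bits (r + c)) (List (Bits r)), (∀ y, (A y).MakesAtMost q) →
        p ≤ preimageProb l A →
          κ * ((2 : ℝ) ^ min r c / ((r + c : ℕ) : ℝ)) ^ (1 / 4 : ℝ) ≤ (q : ℝ)) := by
  refine ⟨⟨73, by norm_num, fun r c q l hr _ hl A hA => collisionProb_le hr hl A hA⟩,
    fun p hp => ⟨(p / 73) ^ (1 / 4 : ℝ), by positivity, fun r c q l hr _ hl A hA hpA =>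
      le_query_of_le_bound (by norm_num) hp hr (collisionProb_le hr hl A hA) hpA⟩,
    ⟨73, by norm_num, fun r c q l hr _ hq hl A hA => preimageProb_le hr hq hl A hA⟩,
    fun p hp => ⟨(p / 73) ^ (1 / 4 : ℝ), by positivity, fun r c q l hr _ hq hl A hA hpA =>
      le_query_of_le_bound (by norm_num) hp hr (preimageProb_le hr hq hl A hA) hpA⟩⟩
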